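/- Let $d\ge 2$ and $1\le n_{\rm e}\le n$ be integers. Consider codes that encode one logical qudit, with space $\mathbb C^d$, into $n$ physical qudits, with space $(\mathbb C^d)^{\otimes n}$. For $V\in\mathrm{SU}(d)$ write $\mathcal V(\cdot)=V(\cdot)V^\dagger$, fix a subset $T\subseteq\{1,\dots,n\}$, and let $\mathcal V_{\rm phys}=\mathcal V_1\otimes\cdots\otimes\mathcal V_n$, where $\mathcal V_i=\mathcal V$ for $i\in T$ and $\mathcal V_i$ is the identity channel for $i\notin T$. An encoding channel $\mathcal E$ (completely positive and trace preserving) is called $\mathrm{SU}(d)$-covariant if $\mathcal E\circ\mathcal V=\mathcal V_{\rm phys}\circ\mathcal E$ for all $V\in\mathrm{SU}(d)$. Let the noise be the weak erasure channel $$\mathcal C=\binom{n}{n_{\rm e}}^{-1}\sum_{s\subseteq\{1,\dots,n\},\ |s|=n_{\rm e}}(\mathcal C_{\rm e})_s ,$$ where $(\mathcal C_{\rm e})_s$ erases the qudits with labels in $s$, replacing each of them by a fixed state $|d+1\rangle$ orthogonal to the original $\mathbb C^d$. For an encoder $\mathcal E$ and a decoding channel $\mathcal D$ from $(\mathbb C^{d+1})^{\otimes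 n}$ to $\mathbb C^d$, the error of the code $(\mathcal E,\mathcal D)$ is $$\epsilon_{\rm cov}=\sup_{V\in\mathrm{SU}(d)}\ \tfrac12\bigl\|\mathcal D\circ\mathcal C\circ\mathcal V_{\rm phys}\circ\mathcal E-\mathcal V\bigr\|_\diamond ,$$ where $\|\cdot\|_\diamond$ is the diamond norm. Then, for every $T$, every $\mathrm{SU}(d)$-covariant encoding channel $\mathcal E$ and every decoding channel $\mathcal D$, $$\epsilon_{\rm cov}\ \ge\ \frac{1}{16\,n^2\,(1+1/n_{\rm e})}.$$ -/

import Mathlib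

open scoped Matrix ComplexOrder ENNReal

namespace CovCode

noncomputable section

/-- A linear map between spaces of operators on `ℂ^ι` and `ℂ^κ`. -/
abbrev SuperOp (ι κ : Type) : Type := Matrix ι ι ℂ →ₗ[ℂ] Matrix κ κ ℂ

/-- A density operator: positive semidefinite with unit trace. -/
def IsState {ι : Type} [Fintype ι] (ρ : Matrix ι ι ℂ) : Prop :=
  ρ.PosSemidef ∧ ρ.trace = 1

/-- `Φ ⊗ id` on the operators on `ℂ^ι ⊗ ℂ^k`. -/
def ampliate {ι κ : Type} (k : ℕ) (Φ : SuperOp ι κ)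
    (X : Matrix (ι × Fin k) (ι × Fin k) ℂ) : Matrix (κ × Fin k) (κ × Fin k) ℂ :=
  Matrix.of fun p q => Φ (Matrix.of fun a b => X (a, p.2) (b, q.2)) p.1 q.1

/-- A quantum channel: a completely positive trace-preserving linear map. -/
structure IsChannel {ι κ : Type} [Fintype ι] [Fintype κ] (Φ : SuperOp ι κ) : Prop where
  completely_positive : ∀ (k : ℕ) (X : Matrix (ι × Fin k) (ι × Fin k) ℂ),
    X.PosSemidef → (ampliate k Φ X).PosSemidef
  trace_preserving : ∀ X : Matrix ι ι ℂ, (Φ X).trace = X.trace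

/-- The map `X ↦ K X K†`. -/
def conj {ι κ : Type} [Fintype ι] (K : Matrix κ ι ℂ) : SuperOp ι κ where
  toFun X := K * X * Kᴴ
  map_add' X Y := by rw [Matrix.mul_add, Matrix.add_mul]
  map_smul' c X := by simp

/-- The trace norm: the sum of the singular values, that is, of the square roots of the
eigenvalues of `A† A`. -/
def traceNorm {ι : Type} [Fintype ι] [DecidableEq ι] (A : Matrix ι ι ℂ) : ℝ :=
  ∑ i, √((Matrix.isHermitian_conjTranspose_mul_self A).eigenvalues i)

/-- The diamond norm error `½ ‖Φ - Ψ‖_⋄`: half the supremum, over all finite-dimensional reference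
systems `ℂ^k` and all joint input states, of the trace distance norm of the outputs.  It is
valued in `[0, ∞]`, so that the supremum needs no boundedness proof. -/
def epsWC {ι κ : Type} [Fintype ι] [Fintype κ] [DecidableEq κ] (Φ Ψ : SuperOp ι κ) : ℝ≥0∞ :=
  ⨆ (k : ℕ) (ρ : Matrix (ι × Fin k) (ι × Fin k) ℂ) (_ : IsState ρ),
    ENNReal.ofReal (1 / 2 * traceNorm (ampliate k Φ ρ - ampliate k Ψ ρ))

/-- The tensor product `A₁ ⊗ ⋯ ⊗ Aₙ`, as a matrix in the product bases. -/
def tensor {n : ℕ} {α β : Type} (A : Fin n → Matrix β α ℂ) :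
    Matrix (Fin n → β) (Fin n → α) ℂ :=
  Matrix.of fun y x => ∏ i, A i (y i) (x i)

/-- `V₁ ⊗ ⋯ ⊗ Vₙ`, where `Vᵢ = V` for `i ∈ T` and `Vᵢ` is the identity for `i ∉ T`. -/
def transversal {n d : ℕ} (T : Finset (Fin n)) (V : Matrix (Fin d) (Fin d) ℂ) :
    Matrix (Fin n → Fin d) (Fin n → Fin d) ℂ :=
  tensor fun i => if i ∈ T then V else 1

/-- `SU(d)`-covariance of an encoder of one qudit into `n` qudits:
`E ∘ 𝒱 = (𝒱₁ ⊗ ⋯ ⊗ 𝒱ₙ) ∘ E` for all `V ∈ SU(d)`. -/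
def IsCovariant {n d : ℕ} (T : Finset (Fin n)) (E : SuperOp (Fin d) (Fin n → Fin d)) : Prop :=
  ∀ V ∈ Matrix.specialUnitaryGroup (Fin d) ℂ,
    E ∘ₗ conj V = conj (transversal T V) ∘ₗ E

/-- The operator `|e⟩⟨c| : ℂ^d → ℂ^(d+1)`, where `none` labels the extra basis vector `|e⟩`
(the state of an erased qudit). -/
def flagOp {d : ℕ} (c : Fin d) : Matrix (Option (Fin d)) (Fin d) ℂ :=
  Matrix.of fun y x => if y = none ∧ x = c then 1 else 0

/-- The inclusion `ℂ^d → ℂ^(d+1)` of a qudit that is not erased. -/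
def keepOp {d : ℕ} : Matrix (Option (Fin d)) (Fin d) ℂ :=
  Matrix.of fun y x => if y = some x then 1 else 0

/-- The erasure of the qudits with labels in `s`: each of them is replaced by `|e⟩`. The Kraus
operators are indexed by the assignments `c` of a basis label to each element of `s`. -/
def erase {n : ℕ} (d : ℕ) (s : Finset (Fin n)) :
    SuperOp (Fin n → Fin d) (Fin n → Option (Fin d)) :=
  ∑ c : s → Fin d, conj (tensor fun i => if h : i ∈ s then flagOp (c ⟨i, h⟩) else keepOp)

/-- The weak erasure noise: a uniformly random set of exactly `nₑ` of the `n` qudits is erased. -/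
def weakErasure (n d nₑ : ℕ) : SuperOp (Fin n → Fin d) (Fin n → Option (Fin d)) :=
  ∑ s ∈ Finset.powersetCard nₑ (Finset.univ : Finset (Fin n)),
    (1 / (n.choose nₑ : ℂ)) • erase d s

/-- The error of a code `(E, D)` under the noise `C`: the supremum over `V ∈ SU(d)` of
`½ ‖D ∘ C ∘ (𝒱₁ ⊗ ⋯ ⊗ 𝒱ₙ) ∘ E - 𝒱‖_⋄`. -/
def epsCov {n d : ℕ} {κ : Type} (T : Finset (Fin n)) (C : SuperOp (Fin n → Fin d) κ)
    (E : SuperOp (Fin d) (Fin n → Fin d)) (D : SuperOp κ (Fin d)) : ℝ≥0∞ :=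
  ⨆ V : Matrix.specialUnitaryGroup (Fin d) ℂ,
    epsWC (D ∘ₗ C ∘ₗ conj (transversal T V.1) ∘ₗ E) (conj V.1)

end

end CovCode

/-! An accurate code must hide from the environment which basis state was encoded, but covariance
makes the erased qudits leak it through their charge. Only the diagonal unitary `exp (iθH)` is used,
with `H` equal to `±1/2` on two basis states `p`, `q` and zero elsewhere, and only the error at `V =
1` is bounded.

The Kraus operators of the encoder can be chosen to shift the charge phase by a definite amount `m
a` (`IsChannel.exists_kraus`), so `m a` and the physical charge fix the logical one. The environment
holds the label `a` and the erased qudits, whose charge times `n / nₑ` is an unbiased estimate of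
the physical charge. Hence a phase `g` of the environment has mean `exp (iθ h x)` on the input `x`,
up to an error `δ = (θn/2)²` of second order (`exists_kraus_phase`).

With `θ = 2x` these means are near `exp (±ix)` on `p` and `q`. They differ by about `2x`, while the
mean square of `g - 1` is at most `x² + 2δ`, so by Cauchy-Schwarz the squared Hellinger distance of
the two environment distributions is at least about `(x - δ)² / (x² + 2δ)`
(`le_sum_sub_sq_of_phase`). It is also at most four times the infidelity on a maximally entangled
qubit (`sum_sqrt_sub_sqrt_sq_le`), which is at most the error (`one_sub_fidelity_le_epsWC`). Taking
`x` of order `1/n²` gives `1/(16n²)`, more than is claimed. -/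

namespace CovCode

/-! ### Trace norm and projective tests -/

section TraceNorm

theorem sum_norm_sq_eq_conjTranspose_mul_self {ι κ : Type} [Fintype κ] (G : Matrix κ ι ℂ) (i : ι) :
    ((∑ k, ‖G k i‖ ^ 2 : ℝ) : ℂ) = (Gᴴ * G) i i := by
  simp only [Matrix.mul_apply, Matrix.conjTranspose_apply, Complex.star_def, Complex.conj_mul']
  push_cast
  rfl

theorem norm_conjTranspose_mul_apply_le {ι κ : Type} [Fintype κ] (C G : Matrix κ ι ℂ) (i : ι) :
    ‖(Cᴴ * G) i i‖ ≤ √(∑ k, ‖C k i‖ ^ 2) * √(∑ k, ‖G k i‖ ^ 2) := by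
  rw [Matrix.mul_apply]
  refine (norm_sum_le _ _).trans ?_
  simp only [Matrix.conjTranspose_apply, norm_mul, norm_star]
  exact Real.sum_mul_le_sqrt_mul_sqrt _ _ _

variable {ι : Type} [Fintype ι]

/-- In an eigenbasis `U` of `A† A` the columns of `A * U` have the singular values as norms, and
those of `B† * U` are unit vectors; Cauchy-Schwarz applies column by column. -/
theorem norm_trace_mul_le_traceNorm [DecidableEq ι] {B : Matrix ι ι ℂ} (hB : B * Bᴴ = 1)
    (A : Matrix ι ι ℂ) : ‖(B * A).trace‖ ≤ traceNorm A := by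
  have hA := Matrix.isHermitian_conjTranspose_mul_self A
  set U : Matrix ι ι ℂ := hA.eigenvectorUnitary.1 with hU
  have hUU : Uᴴ * U = 1 := Unitary.coe_star_mul_self hA.eigenvectorUnitary
  have hUU' : U * Uᴴ = 1 := Unitary.coe_mul_star_self hA.eigenvectorUnitary
  have key : (B * A).trace = ((Bᴴ * U)ᴴ * (A * U)).trace := by
    rw [Matrix.conjTranspose_mul, Matrix.conjTranspose_conjTranspose, Matrix.mul_assoc,
      Matrix.trace_mul_comm Uᴴ, Matrix.mul_assoc, Matrix.mul_assoc, hUU', Matrix.mul_one]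
  rw [key, Matrix.trace, traceNorm]
  refine (norm_sum_le _ _).trans (Finset.sum_le_sum fun i _ => ?_)
  refine (norm_conjTranspose_mul_apply_le _ _ i).trans (le_of_eq ?_)
  have h1 : ∑ k, ‖(Bᴴ * U) k i‖ ^ 2 = 1 := by
    have := sum_norm_sq_eq_conjTranspose_mul_self (Bᴴ * U) i
    rw [Matrix.conjTranspose_mul, Matrix.conjTranspose_conjTranspose, Matrix.mul_assoc,
      ← Matrix.mul_assoc B, hB, Matrix.one_mul, hUU, Matrix.one_apply_eq] at this
    exact_mod_cast this
  have h2 : ∑ k, ‖(A * U) k i‖ ^ 2 = hA.eigenvalues i := by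
    have := sum_norm_sq_eq_conjTranspose_mul_self (A * U) i
    have h3 := hA.conjStarAlgAut_star_eigenvectorUnitary
    rw [Unitary.conjStarAlgAut_star_apply, Matrix.star_eq_conjTranspose, ← hU] at h3
    rw [Matrix.conjTranspose_mul, Matrix.mul_assoc, ← Matrix.mul_assoc Aᴴ, ← Matrix.mul_assoc, h3,
      Matrix.diagonal_apply_eq] at this
    exact Complex.ofReal_injective this
  rw [h1, h2, Real.sqrt_one, one_mul]

/-- The probability that a projective test distinguishes two operators of equal trace is at most
half their trace distance. -/
theorem norm_trace_proj_mul_le [DecidableEq ι] {P : Matrix ι ι ℂ} (hP : P.IsHermitian)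
    (hPP : P * P = P) {A : Matrix ι ι ℂ} (hA : A.trace = 0) :
    ‖(P * A).trace‖ ≤ 1 / 2 * traceNorm A := by
  -- The reflection `2P - 1` is unitary, and `A` has trace zero, so testing with it doubles the
  -- trace against `P`.
  have h : (2 • P - 1) * (2 • P - 1)ᴴ = 1 := by
    rw [Matrix.conjTranspose_sub, Matrix.conjTranspose_smul, hP.eq, Matrix.conjTranspose_one]
    simp only [star_trivial, sub_mul, mul_sub, one_mul, mul_one, smul_mul_assoc, mul_smul_comm, hPP]
    abel
  have := norm_trace_mul_le_traceNorm h A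
  rw [sub_mul, one_mul, Matrix.trace_sub, hA, sub_zero, smul_mul_assoc, Matrix.trace_smul,
    nsmul_eq_mul, norm_mul] at this
  norm_num at this
  linarith

end TraceNorm

/-! ### Kraus operators adapted to a symmetry -/

section Kraus

variable {ι κ : Type} [Fintype ι] [DecidableEq ι]

/-- The Choi matrix of a map of operators. -/
def choi (Φ : SuperOp ι κ) : Matrix (κ × ι) (κ × ι) ℂ :=
  Matrix.of fun p q => Φ (Matrix.single p.2 q.2 1) p.1 q.1

/-- The Choi matrix is, up to relabelling the reference, the image of an unnormalized maximally
entangled state. -/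
theorem IsChannel.choi_posSemidef [Fintype κ] {Φ : SuperOp ι κ} (hΦ : IsChannel Φ) : (choi Φ).PosSemidef := by
  classical
  let e := Fintype.equivFin ι
  let u : ι × Fin (Fintype.card ι) → ℂ := fun p => if e p.1 = p.2 then 1 else 0
  have h := (hΦ.completely_positive _ _ (Matrix.posSemidef_vecMulVec_self_star u)).submatrix
    (fun p : κ × ι => (p.1, e p.2))
  convert h using 1
  ext p q
  simp only [choi, ampliate, Matrix.of_apply, Matrix.submatrix_apply]
  suffices h : Matrix.single p.2 q.2 1 = Matrix.of fun a b =>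
      Matrix.vecMulVec u (star u) (a, e p.2) (b, e q.2) by rw [h]
  ext a b
  simp only [Matrix.single_apply, Matrix.of_apply, Matrix.vecMulVec_apply, Pi.star_apply, u,
    EmbeddingLike.apply_eq_iff_eq, apply_ite star, star_one, star_zero]
  by_cases h1 : a = p.2 <;> by_cases h2 : b = q.2 <;> simp [h1, h2, eq_comm]

theorem superOp_apply (Φ : SuperOp ι κ) (X : Matrix ι ι ℂ) (y y' : κ) :
    Φ X y y' = ∑ x, ∑ x', X x x' * choi Φ (y, x) (y', x') := by
  conv_lhs => rw [Matrix.matrix_eq_sum_single X]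
  simp only [map_sum, Matrix.sum_apply, choi, Matrix.of_apply]
  refine Finset.sum_congr rfl fun x _ => Finset.sum_congr rfl fun x' _ => ?_
  rw [← mul_one (X x x'), ← smul_eq_mul, ← Matrix.smul_single, map_smul, Matrix.smul_apply,
    smul_eq_mul, smul_eq_mul, mul_one]

theorem sum_conjTranspose_mul_self_eq_one [Fintype κ] {A : Type} [Fintype A] {Φ : SuperOp ι κ}
    (hΦ : ∀ X, (Φ X).trace = X.trace) {K : A → Matrix κ ι ℂ} (hK : Φ = ∑ a, conj (K a)) :
    ∑ a, (K a)ᴴ * K a = 1 := by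
  ext i j
  have h := hΦ (Matrix.single j i 1)
  have h1 : (Φ (Matrix.single j i 1)).trace =
      ((∑ a, (K a)ᴴ * K a) * Matrix.single j i 1).trace := by
    rw [hK, LinearMap.sum_apply, Matrix.trace_sum, Finset.sum_mul, Matrix.trace_sum]
    refine Finset.sum_congr rfl fun a _ => ?_
    simp only [conj, LinearMap.coe_mk, AddHom.coe_mk]
    rw [Matrix.trace_mul_comm, Matrix.mul_assoc]
  rw [h1, Matrix.trace_mul_single, MulOpposite.op_one, one_smul] at h
  rw [h]
  by_cases hij : i = j
  · subst hij; simp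
  · rw [Matrix.trace_single_eq_of_ne _ _ _ (Ne.symm hij), Matrix.one_apply_ne hij]

/-- A channel that intertwines two diagonal unitaries has Kraus operators each of which
intertwines them up to a phase. -/
theorem IsChannel.exists_kraus [Fintype κ] [DecidableEq κ] {Φ : SuperOp ι κ} (hΦ : IsChannel Φ)
    (v : ι → ℂ) (w : κ → ℂ) (hv : ∀ x, ‖v x‖ = 1) (hw : ∀ y, ‖w y‖ = 1)
    (hcov : Φ ∘ₗ conj (Matrix.diagonal v) = conj (Matrix.diagonal w) ∘ₗ Φ) :
    ∃ K : κ × ι → Matrix κ ι ℂ, Φ = ∑ a, conj (K a) ∧ ∑ a, (K a)ᴴ * K a = 1 ∧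
      ∃ m : κ × ι → ℂ, (∀ a, ‖m a‖ = 1) ∧ ∀ a y x, w y * K a y x = m a * K a y x * v x := by
  open scoped MatrixOrder in
  have hJ := hΦ.choi_posSemidef
  set S := CFC.sqrt (choi Φ)
  have hSS : S * S = choi Φ := CFC.sqrt_mul_sqrt_self _ hJ.nonneg
  have hSh : S.IsHermitian := (Matrix.nonneg_iff_posSemidef.mp (CFC.sqrt_nonneg (choi Φ))).1
  have hvv : ∀ x, v x * star (v x) = 1 := fun x => by
    rw [Complex.star_def, Complex.mul_conj', hv]; simp
  have hww : ∀ x, w x * star (w x) = 1 := fun x => by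
    rw [Complex.star_def, Complex.mul_conj', hw]; simp
  let m : κ × ι → ℂ := fun a => w a.1 * star (v a.2)
  have hJm : Commute (choi Φ) (Matrix.diagonal m) := by
    ext p q
    rw [Matrix.mul_diagonal, Matrix.diagonal_mul]
    have h := congr_fun₂ (LinearMap.congr_fun hcov (Matrix.single p.2 q.2 1)) p.1 q.1
    have h1 : conj (Matrix.diagonal v) (Matrix.single p.2 q.2 1) =
        (v p.2 * star (v q.2)) • Matrix.single p.2 q.2 (1 : ℂ) := by
      ext a b
      simp only [conj, LinearMap.coe_mk, AddHom.coe_mk, Matrix.diagonal_conjTranspose,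
        Matrix.mul_diagonal, Matrix.diagonal_mul, Matrix.smul_apply, Matrix.single_apply,
        Pi.star_apply]
      split_ifs with hab
      · rw [hab.1, hab.2]; simp
      · simp
    rw [LinearMap.comp_apply, LinearMap.comp_apply, h1, map_smul] at h
    simp only [conj, LinearMap.coe_mk, AddHom.coe_mk, Matrix.diagonal_conjTranspose,
      Matrix.mul_diagonal, Matrix.diagonal_mul, Matrix.smul_apply, Pi.star_apply,
      smul_eq_mul] at h
    change choi Φ p q * m q = m p * choi Φ p q
    have h' : v p.2 * star (v q.2) * choi Φ p q = w p.1 * choi Φ p q * star (w q.1) := h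
    simp only [m]
    linear_combination (star (v p.2) * w q.1) * h' - (choi Φ p q * star (v q.2) * w q.1) * hvv p.2
      + (choi Φ p q * w p.1 * star (v p.2)) * hww q.1
  -- The square root is a function of the Choi matrix, so it inherits the symmetry; its columns are
  -- the Kraus operators.
  have hSm : Commute S (Matrix.diagonal m) := Commute.cfcₙ_nnreal hJm _
  have hrep : Φ = ∑ a, conj (Matrix.of fun y x => S (y, x) a) := by
    refine LinearMap.ext fun X => ?_
    ext y y'
    rw [superOp_apply, LinearMap.sum_apply, Matrix.sum_apply]
    simp only [conj, LinearMap.coe_mk, AddHom.coe_mk, Matrix.mul_apply, Matrix.of_apply,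
      Matrix.conjTranspose_apply, ← hSS]
    simp only [Finset.sum_mul, Finset.mul_sum]
    rw [Finset.sum_comm, Finset.sum_comm (s := (Finset.univ : Finset (κ × ι)))]
    refine Finset.sum_congr rfl fun x' _ => ?_
    rw [Finset.sum_comm]
    refine Finset.sum_congr rfl fun a _ => Finset.sum_congr rfl fun x _ => ?_
    rw [← hSh.apply a (y', x')]
    ring
  refine ⟨_, hrep, sum_conjTranspose_mul_self_eq_one hΦ.trace_preserving hrep, m, fun a => ?_,
    fun a y x => ?_⟩
  · simp only [m, norm_mul, norm_star, hv, hw, mul_one]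
  · have h := congr_fun₂ hSm (y, x) a
    rw [Matrix.mul_diagonal, Matrix.diagonal_mul] at h
    change w y * S (y, x) a = m a * S (y, x) a * v x
    have h' : S (y, x) a * m a = w y * star (v x) * S (y, x) a := h
    linear_combination (- v x) * h' - (w y * S (y, x) a) * hvv x

end Kraus
end CovCode
namespace CovCode

/-! ### Phases and Hellinger distance -/

section Hellinger

variable {J : Type} [Fintype J]

/-- Mean values of a function in two distributions `a²` and `b²` of small Hellinger distance. -/
theorem norm_sum_sq_sub_sq_mul_le (a b : J → ℝ) (f : J → ℂ) :
    ‖∑ j, ((a j ^ 2 - b j ^ 2 : ℝ) : ℂ) * f j‖ ^ 2 ≤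
      (∑ j, (a j - b j) ^ 2) * (2 * (∑ j, a j ^ 2 * ‖f j‖ ^ 2 + ∑ j, b j ^ 2 * ‖f j‖ ^ 2)) := by
  have h1 : ‖∑ j, ((a j ^ 2 - b j ^ 2 : ℝ) : ℂ) * f j‖ ≤
      ∑ j, |a j - b j| * (|a j + b j| * ‖f j‖) := by
    refine (norm_sum_le _ _).trans (Finset.sum_le_sum fun j _ => le_of_eq ?_)
    rw [norm_mul, Complex.norm_real, Real.norm_eq_abs, ← mul_assoc, ← abs_mul]
    congr 2
    ring
  calc _ ≤ (∑ j, |a j - b j| * (|a j + b j| * ‖f j‖)) ^ 2 := by gcongr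
    _ ≤ (∑ j, |a j - b j| ^ 2) * ∑ j, (|a j + b j| * ‖f j‖) ^ 2 :=
      Finset.sum_mul_sq_le_sq_mul_sq _ _ _
    _ ≤ _ := by
      simp only [sq_abs, mul_pow]
      gcongr
      rw [← Finset.sum_add_distrib, Finset.mul_sum]
      refine Finset.sum_le_sum fun j _ => ?_
      have := mul_nonneg (sq_nonneg (a j - b j)) (sq_nonneg ‖f j‖)
      nlinarith

theorem sum_sq_mul_norm_sub_one_sq {a : J → ℝ} (ha : ∑ j, a j ^ 2 = 1) {g : J → ℂ}
    (hg : ∀ j, ‖g j‖ = 1) :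
    ∑ j, a j ^ 2 * ‖g j - 1‖ ^ 2 = 2 - 2 * (∑ j, ((a j ^ 2 : ℝ) : ℂ) * g j).re := by
  have h : ∀ j, ‖g j - 1‖ ^ 2 = 2 - 2 * (g j).re := fun j => by
    have h2 : (g j).re ^ 2 + (g j).im ^ 2 = 1 := by
      have := Complex.sq_norm (g j)
      rw [hg, Complex.normSq_apply] at this
      linarith
    rw [Complex.sq_norm, Complex.normSq_apply, Complex.sub_re, Complex.sub_im, Complex.one_re,
      Complex.one_im]
    linarith
  simp only [h, mul_sub, Finset.sum_sub_distrib, ← Finset.sum_mul, ha, Complex.re_sum,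
    Complex.re_ofReal_mul, Finset.mul_sum]
  rw [one_mul]
  congr 1
  exact Finset.sum_congr rfl fun j _ => by ring

/-- If two distributions `a²` and `b²` give a phase `g` mean values close to `exp (±ix)`, then
their squared Hellinger distance is not too small. -/
theorem le_sum_sub_sq_of_phase {a b : J → ℝ} (ha : ∑ j, a j ^ 2 = 1) (hb : ∑ j, b j ^ 2 = 1)
    {g : J → ℂ} (hg : ∀ j, ‖g j‖ = 1) {x δ : ℝ}
    (hga : ‖∑ j, ((a j ^ 2 : ℝ) : ℂ) * g j - Complex.exp (x * Complex.I)‖ ≤ δ)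
    (hgb : ‖∑ j, ((b j ^ 2 : ℝ) : ℂ) * g j - Complex.exp (-x * Complex.I)‖ ≤ δ)
    (hδ : δ ≤ Real.sin x) :
    (Real.sin x - δ) ^ 2 ≤ (∑ j, (a j - b j) ^ 2) * (x ^ 2 + 2 * δ) := by
  set A := ∑ j, ((a j ^ 2 : ℝ) : ℂ) * g j with hA
  set B := ∑ j, ((b j ^ 2 : ℝ) : ℂ) * g j with hB
  have hcos := Real.one_sub_sq_div_two_le_cos (x := x)
  have hsub : ∀ f : J → ℂ, ∑ j, ((a j ^ 2 - b j ^ 2 : ℝ) : ℂ) * f j =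
      ∑ j, ((a j ^ 2 : ℝ) : ℂ) * f j - ∑ j, ((b j ^ 2 : ℝ) : ℂ) * f j := fun f => by
    rw [← Finset.sum_sub_distrib]
    exact Finset.sum_congr rfl fun j _ => by push_cast; ring
  have hAB : ∑ j, ((a j ^ 2 - b j ^ 2 : ℝ) : ℂ) * (g j - 1) = A - B := by
    simp only [mul_sub, mul_one, Finset.sum_sub_distrib, hsub, ← Complex.ofReal_sum]
    rw [ha, hb, sub_self, Complex.ofReal_zero, sub_zero]
  have hre : ∀ {z w : ℂ}, ‖z - w‖ ≤ δ → w.re - δ ≤ z.re := fun {z w} h => by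
    have := (abs_le.mp ((Complex.abs_re_le_norm (z - w)).trans h)).1
    rw [Complex.sub_re] at this
    linarith
  have hAre := hre hga
  have hBre := hre hgb
  rw [Complex.exp_ofReal_mul_I_re] at hAre
  rw [← Complex.ofReal_neg, Complex.exp_ofReal_mul_I_re, Real.cos_neg] at hBre
  have hnorm : 2 * (Real.sin x - δ) ≤ ‖A - B‖ := by
    have h1 : A - B = (Complex.exp (x * Complex.I) - Complex.exp (-x * Complex.I)) +
        (A - Complex.exp (x * Complex.I)) - (B - Complex.exp (-x * Complex.I)) := by ring
    have h2 : 2 * Real.sin x ≤ ‖Complex.exp (x * Complex.I) - Complex.exp (-x * Complex.I)‖ := by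
      refine le_trans (le_of_eq ?_) (Complex.im_le_norm _)
      rw [Complex.sub_im, Complex.exp_ofReal_mul_I_im, ← Complex.ofReal_neg,
        Complex.exp_ofReal_mul_I_im, Real.sin_neg]
      ring
    have h3 := norm_sub_norm_le (Complex.exp (x * Complex.I) - Complex.exp (-x * Complex.I))
      ((B - Complex.exp (-x * Complex.I)) - (A - Complex.exp (x * Complex.I)))
    have h4 := norm_sub_le (B - Complex.exp (-x * Complex.I)) (A - Complex.exp (x * Complex.I))
    rw [h1]
    rw [show ∀ u v w : ℂ, u + v - w = u - (w - v) from fun u v w => by ring]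
    linarith
  -- Subtracting 1 from `g` leaves the difference of the means unchanged, but makes the second
  -- moments small.
  have key := norm_sum_sq_sub_sq_mul_le a b fun j => g j - 1
  rw [hAB, sum_sq_mul_norm_sub_one_sq ha hg, sum_sq_mul_norm_sub_one_sq hb hg] at key
  have h5 : (2 * (Real.sin x - δ)) ^ 2 ≤ ‖A - B‖ ^ 2 :=
    pow_le_pow_left₀ (by linarith) hnorm 2
  have h6 : (∑ j, (a j - b j) ^ 2) * (2 * (2 - 2 * A.re + (2 - 2 * B.re))) ≤
      (∑ j, (a j - b j) ^ 2) * (4 * (x ^ 2 + 2 * δ)) := by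
    refine mul_le_mul_of_nonneg_left ?_ (Finset.sum_nonneg fun j _ => sq_nonneg _)
    linarith
  linarith

end Hellinger

/-! ### Characteristic function of a sampled charge -/

section CharacteristicFunction

/-- The characteristic function of a bounded random variable to first order in its argument. -/
theorem norm_sum_exp_sub_card_le {S : Type} (s : Finset S) {O : S → ℝ} {μ M θ : ℝ}
    (hO : ∑ r ∈ s, O r = s.card * μ) (hM : ∀ r ∈ s, |O r| ≤ M)
    (hθ : ∀ r ∈ s, |θ * (O r - μ)| ≤ 1) :
    ‖∑ r ∈ s, Complex.exp ((θ * (O r - μ) : ℝ) * Complex.I) - s.card‖ ≤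
      s.card * (θ * M) ^ 2 := by
  -- The linear term may be subtracted because it averages to zero around the mean `μ`.
  have h1 : ∑ r ∈ s, Complex.exp ((θ * (O r - μ) : ℝ) * Complex.I) - s.card =
      ∑ r ∈ s, (Complex.exp ((θ * (O r - μ) : ℝ) * Complex.I) - 1 -
        (θ * (O r - μ) : ℝ) * Complex.I) := by
    have : ∑ r ∈ s, ((θ * (O r - μ) : ℝ) : ℂ) * Complex.I = 0 := by
      rw [← Finset.sum_mul, ← Complex.ofReal_sum, ← Finset.mul_sum, Finset.sum_sub_distrib, hO]
      simp
    simp only [Finset.sum_sub_distrib, this]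
    simp
  have h2 : ∑ r ∈ s, (O r - μ) ^ 2 = ∑ r ∈ s, O r ^ 2 - s.card * μ ^ 2 := by
    have : ∀ r, (O r - μ) ^ 2 = O r ^ 2 - 2 * μ * O r + μ ^ 2 := fun r => by ring
    simp only [this, Finset.sum_add_distrib, Finset.sum_sub_distrib, ← Finset.mul_sum, hO]
    simp
    ring
  have h3 : ∑ r ∈ s, O r ^ 2 ≤ s.card * M ^ 2 := by
    rw [← nsmul_eq_mul]
    exact Finset.sum_le_card_nsmul _ _ _ fun r hr => sq_le_sq.mpr ((hM r hr).trans (le_abs_self M))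
  calc _ ≤ ∑ r ∈ s, (θ * (O r - μ)) ^ 2 := by
        rw [h1]
        refine (norm_sum_le _ _).trans (Finset.sum_le_sum fun r hr => ?_)
        have h : ‖((θ * (O r - μ) : ℝ) : ℂ) * Complex.I‖ = |θ * (O r - μ)| := by
          rw [norm_mul, Complex.norm_I, mul_one, Complex.norm_real, Real.norm_eq_abs]
        have := Complex.norm_exp_sub_one_sub_id_le (h.le.trans (hθ r hr))
        rwa [h, sq_abs] at this
    _ = θ ^ 2 * (∑ r ∈ s, O r ^ 2 - s.card * μ ^ 2) := by
        simp only [mul_pow, ← Finset.mul_sum, h2]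
    _ ≤ θ ^ 2 * (s.card * M ^ 2) := by
        refine mul_le_mul_of_nonneg_left ?_ (sq_nonneg _)
        nlinarith [mul_nonneg (Nat.cast_nonneg (α := ℝ) s.card) (sq_nonneg μ)]
    _ = _ := by ring

/-- Each `i` lies in `(n - 1).choose (k - 1)` of the sets, a fraction `k / n` of them. -/
theorem sum_powersetCard_sum {n k : ℕ} (hk : 1 ≤ k) (hn : k ≤ n) (h : Fin n → ℝ) :
    ∑ s ∈ Finset.powersetCard k (Finset.univ : Finset (Fin n)), (n / k : ℝ) * ∑ i ∈ s, h i =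
      n.choose k * ∑ i, h i := by
  have h1 : ∀ s ∈ Finset.powersetCard k (Finset.univ : Finset (Fin n)),
      ∑ i ∈ s, h i = ∑ i, if {i} ⊆ s then h i else 0 := fun s _ => by
    simp
  have h2 : (n / k : ℝ) * (n - 1).choose (k - 1) = n.choose k := by
    obtain ⟨k, rfl⟩ := Nat.exists_eq_add_of_le' hk
    obtain ⟨n, rfl⟩ := Nat.exists_eq_add_of_le' (hk.trans hn)
    have := Nat.add_one_mul_choose_eq n k
    rw [Nat.add_sub_cancel, Nat.add_sub_cancel, div_mul_eq_mul_div, div_eq_iff (by positivity)]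
    exact_mod_cast this
  rw [← Finset.mul_sum, Finset.sum_congr rfl h1, Finset.sum_comm, ← h2, mul_assoc]
  congr 1
  rw [Finset.mul_sum]
  refine Finset.sum_congr rfl fun i _ => ?_
  rw [← Finset.sum_filter, Finset.sum_const, Finset.card_filter_powersetCard_subset _ _ _
    (Finset.subset_univ _) (by simpa using hk)]
  simp

end CharacteristicFunction

end CovCode
namespace CovCode

/-! ### Kraus operators of the erasure noise -/

section Erasure

variable {n d : ℕ}

theorem tensor_conjTranspose_mul_tensor {α β : Type} [Fintype β] (A B : Fin n → Matrix β α ℂ) :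
    (tensor A)ᴴ * tensor B = tensor fun i => (A i)ᴴ * B i := by
  ext x y
  simp only [Matrix.mul_apply, Matrix.conjTranspose_apply, tensor, Matrix.of_apply,
    Finset.prod_univ_sum, Fintype.piFinset_univ, star_prod, Finset.prod_mul_distrib]

theorem tensor_diagonal {α : Type} [DecidableEq α] (f : Fin n → α → ℂ) :
    tensor (fun i => Matrix.diagonal (f i)) = Matrix.diagonal fun y => ∏ i, f i (y i) := by
  ext y x
  simp only [tensor, Matrix.of_apply]
  by_cases h : y = x
  · subst h
    simp
  · obtain ⟨i, hi⟩ := Function.ne_iff.mp h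
    rw [Matrix.diagonal_apply_ne _ h]
    exact Finset.prod_eq_zero (Finset.mem_univ i) (Matrix.diagonal_apply_ne _ hi)

theorem transversal_diagonal (T : Finset (Fin n)) (v : Fin d → ℂ) :
    transversal T (Matrix.diagonal v) =
      Matrix.diagonal fun y => ∏ i, if i ∈ T then v (y i) else 1 := by
  have : (fun i => if i ∈ T then Matrix.diagonal v else 1) =
      fun i => Matrix.diagonal fun x => if i ∈ T then v x else 1 := by
    funext i
    split_ifs
    · rfl
    · exact Matrix.diagonal_one.symm
  rw [transversal, this, tensor_diagonal]

theorem flagOp_conjTranspose_mul_self (c : Fin d) :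
    (flagOp c)ᴴ * flagOp c = Matrix.diagonal fun x => if c = x then 1 else 0 := by
  ext x y
  simp only [Matrix.mul_apply, Matrix.conjTranspose_apply, flagOp, Matrix.of_apply,
    Fintype.sum_option, Matrix.diagonal_apply]
  by_cases h1 : x = c
  · subst h1
    by_cases h2 : x = y
    · simp [h2]
    · simp [h2, Ne.symm h2]
  · simp [h1, Ne.symm h1]

theorem keepOp_conjTranspose_mul_self :
    (keepOp (d := d))ᴴ * keepOp (d := d) = Matrix.diagonal fun _ => 1 := by
  ext x y
  simp [Matrix.mul_apply, keepOp, Matrix.diagonal_apply, eq_comm]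

/-- The Kraus operators of the erasure of the qudits in `s`. -/
def eraseKraus (s : Finset (Fin n)) (c : s → Fin d) :
    Matrix (Fin n → Option (Fin d)) (Fin n → Fin d) ℂ :=
  tensor fun i => if h : i ∈ s then flagOp (c ⟨i, h⟩) else keepOp

/-- Erasure hands the labels of the qudits in `s` to the environment: the outcome `c` is a
projective measurement in the product basis. -/
theorem eraseKraus_conjTranspose_mul_self (s : Finset (Fin n)) (c : s → Fin d) :
    (eraseKraus s c)ᴴ * eraseKraus s c =
      Matrix.diagonal fun y => if c = fun i : s => y i then 1 else 0 := by
  have h : ∀ i, (if h : i ∈ s then flagOp (c ⟨i, h⟩) else keepOp (d := d))ᴴ *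
      (if h : i ∈ s then flagOp (c ⟨i, h⟩) else keepOp) = Matrix.diagonal fun x =>
        if h : i ∈ s then (if c ⟨i, h⟩ = x then 1 else 0) else 1 := fun i => by
    split_ifs with h
    · exact flagOp_conjTranspose_mul_self _
    · exact keepOp_conjTranspose_mul_self
  rw [eraseKraus, tensor_conjTranspose_mul_tensor]
  simp only [h, tensor_diagonal]
  congr 1
  funext y
  split_ifs with hc
  · refine Finset.prod_eq_one fun i _ => ?_
    split_ifs with h1 h2
    · rfl
    · exact absurd (congr_fun hc ⟨i, h1⟩) h2
    · rfl
  · obtain ⟨i, hi⟩ := Function.ne_iff.mp hc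
    refine Finset.prod_eq_zero (Finset.mem_univ i.1) ?_
    rw [dif_pos i.2, if_neg hi]

theorem sum_smul_eraseKraus (s : Finset (Fin n)) (f : (s → Fin d) → ℂ) :
    ∑ c, f c • ((eraseKraus s c)ᴴ * eraseKraus s c) =
      Matrix.diagonal fun y => f fun i : s => y i := by
  ext y x
  simp only [eraseKraus_conjTranspose_mul_self, Matrix.sum_apply, Matrix.smul_apply, smul_eq_mul]
  by_cases h : y = x
  · subst h
    simp
  · simp [Matrix.diagonal_apply_ne _ h]

/-- The labels of the Kraus operators of the weak erasure noise: the erased set and the basis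
labels of the erased qudits. -/
abbrev WeakErasureIndex (n d k : ℕ) : Type :=
  Σ s : Finset.powersetCard k (Finset.univ : Finset (Fin n)), (s.1 → Fin d)

/-- The Kraus operators of the weak erasure noise. -/
noncomputable def weakErasureKraus {n d k : ℕ} (r : WeakErasureIndex n d k) :
    Matrix (Fin n → Option (Fin d)) (Fin n → Fin d) ℂ :=
  ((√(n.choose k))⁻¹ : ℝ) • eraseKraus r.1.1 r.2

theorem sqrt_choose_inv_mul_self (n k : ℕ) :
    (√(n.choose k : ℝ))⁻¹ * (√(n.choose k : ℝ))⁻¹ = (n.choose k : ℝ)⁻¹ := by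
  rw [← mul_inv, Real.mul_self_sqrt (Nat.cast_nonneg _)]

theorem weakErasure_eq_sum_conj (n d k : ℕ) :
    weakErasure n d k = ∑ r : WeakErasureIndex n d k, conj (weakErasureKraus r) := by
  rw [weakErasure, Fintype.sum_sigma, ← Finset.sum_coe_sort]
  refine Finset.sum_congr rfl fun s _ => ?_
  rw [erase, Finset.smul_sum]
  refine Finset.sum_congr rfl fun c _ => LinearMap.ext fun X => ?_
  simp only [conj, LinearMap.smul_apply, LinearMap.coe_mk, AddHom.coe_mk, weakErasureKraus,
    Matrix.conjTranspose_smul, star_trivial, Matrix.smul_mul, Matrix.mul_smul, smul_smul,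
    sqrt_choose_inv_mul_self, eraseKraus]
  ext y y'
  simp

/-- This is the mean of an environment observable `f`, pulled back to the physical qudits. -/
theorem sum_smul_weakErasureKraus (n d k : ℕ) (f : WeakErasureIndex n d k → ℂ) :
    ∑ r, f r • ((weakErasureKraus r)ᴴ * weakErasureKraus r) = Matrix.diagonal fun y =>
      (n.choose k : ℂ)⁻¹ * ∑ s : Finset.powersetCard k (Finset.univ : Finset (Fin n)),
        f ⟨s, fun i => y i⟩ := by
  rw [Fintype.sum_sigma]
  have h : ∀ s : Finset.powersetCard k (Finset.univ : Finset (Fin n)),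
      ∑ c : s.1 → Fin d, f ⟨s, c⟩ • ((weakErasureKraus ⟨s, c⟩)ᴴ * weakErasureKraus ⟨s, c⟩) =
        Matrix.diagonal fun y => (n.choose k : ℂ)⁻¹ * f ⟨s, fun i => y i⟩ := fun s => by
    rw [← sum_smul_eraseKraus s.1 fun c => (n.choose k : ℂ)⁻¹ * f ⟨s, c⟩]
    refine Finset.sum_congr rfl fun c _ => ?_
    simp only [weakErasureKraus, Matrix.conjTranspose_smul, star_trivial, Matrix.smul_mul,
      Matrix.mul_smul, smul_smul, sqrt_choose_inv_mul_self]
    ext y y'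
    simp only [Matrix.smul_apply, smul_eq_mul, Complex.real_smul]
    push_cast
    ring
  simp only [h]
  ext y x
  by_cases hyx : y = x
  · subst hyx
    simp [Matrix.sum_apply, Finset.mul_sum]
  · simp [Matrix.sum_apply, Matrix.diagonal_apply_ne _ hyx]

end Erasure

/-! ### Entanglement fidelity of a qubit -/

section Fidelity

variable {ι : Type} [DecidableEq ι]

/-- The maximally entangled state of a qubit, embedded by `e`, and a reference qubit. -/
noncomputable def bellState (e : Fin 2 → ι) : Matrix (ι × Fin 2) (ι × Fin 2) ℂ :=
  (1 / 2 : ℂ) • Matrix.vecMulVec (fun x => if x.1 = e x.2 then 1 else 0)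
    (star fun x => if x.1 = e x.2 then 1 else 0)

theorem bellState_apply (e : Fin 2 → ι) (x y : ι × Fin 2) :
    bellState e x y = if x.1 = e x.2 then if y.1 = e y.2 then 1 / 2 else 0 else 0 := by
  simp only [bellState, Matrix.smul_apply, Matrix.vecMulVec_apply, Pi.star_apply]
  split_ifs <;> simp

theorem bellState_isState [Fintype ι] (e : Fin 2 → ι) : IsState (bellState e) := by
  constructor
  · exact (Matrix.posSemidef_vecMulVec_self_star _).smul (by norm_num [Complex.le_def])
  · simp only [Matrix.trace, Matrix.diag_apply, bellState_apply, Fintype.sum_prod_type]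
    rw [Finset.sum_comm]
    simp

theorem bellState_mul_self [Fintype ι] (e : Fin 2 → ι) : bellState e * bellState e = bellState e := by
  ext x y
  rw [Matrix.mul_apply]
  simp only [bellState_apply, Fintype.sum_prod_type]
  rw [Finset.sum_comm]
  by_cases hx : x.1 = e x.2 <;> by_cases hy : y.1 = e y.2 <;> simp [hx, hy]

theorem ampliate_conj_one [Fintype ι] {k : ℕ} (X : Matrix (ι × Fin k) (ι × Fin k) ℂ) :
    ampliate k (conj (1 : Matrix ι ι ℂ)) X = X := by
  ext p q
  simp [ampliate, conj]

theorem trace_ampliate {ι : Type} [Fintype ι] {k : ℕ} {Φ : SuperOp ι ι} (hΦ : ∀ X, (Φ X).trace = X.trace)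
    (X : Matrix (ι × Fin k) (ι × Fin k) ℂ) : (ampliate k Φ X).trace = X.trace := by
  simp only [Matrix.trace, Matrix.diag_apply, Fintype.sum_prod_type_right]
  exact Finset.sum_congr rfl fun l _ => hΦ (Matrix.of fun a b => X (a, l) (b, l))

/-- Each Kraus operator contributes the squared modulus of its expectation `(U₀₀ + U₁₁)/2` in the
entangled state. -/
theorem trace_bellState_mul_ampliate [Fintype ι] (e : Fin 2 → ι) {J : Type} [Fintype J]
    (U : J → Matrix ι ι ℂ) :
    (bellState e * ampliate 2 (∑ j, conj (U j)) (bellState e)).trace =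
      ((∑ j, ‖U j (e 0) (e 0) + U j (e 1) (e 1)‖ ^ 2 / 4 : ℝ) : ℂ) := by
  have h : ∀ k l x y, ampliate 2 (∑ j, conj (U j)) (bellState e) (x, k) (y, l) =
      ∑ j, U j x (e k) * star (U j y (e l)) / 2 := fun k l x y => by
    simp only [ampliate, Matrix.of_apply, LinearMap.sum_apply, Matrix.sum_apply, conj,
      LinearMap.coe_mk, AddHom.coe_mk, Matrix.mul_apply, bellState_apply,
      Matrix.conjTranspose_apply]
    refine Finset.sum_congr rfl fun j _ => ?_
    simp
    ring
  simp only [Matrix.trace, Matrix.diag_apply, Matrix.mul_apply, Fintype.sum_prod_type_right,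
    bellState_apply, h]
  simp only [Fin.sum_univ_two, ite_mul, zero_mul, Finset.sum_ite_eq', Finset.mem_univ, if_true,
    Finset.sum_ite_irrel, Finset.sum_const_zero]
  push_cast
  simp only [Finset.mul_sum, ← Finset.sum_add_distrib]
  refine Finset.sum_congr rfl fun j _ => ?_
  rw [← Complex.mul_conj', map_add]
  simp only [Complex.star_def]
  ring

/-- The error of a channel is at least its infidelity on a maximally entangled qubit. -/
theorem one_sub_fidelity_le_epsWC [Fintype ι] (e : Fin 2 → ι) {J : Type} [Fintype J]
    {U : J → Matrix ι ι ℂ} (hU : ∑ j, (U j)ᴴ * U j = 1) :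
    ENNReal.ofReal (1 - ∑ j, ‖U j (e 0) (e 0) + U j (e 1) (e 1)‖ ^ 2 / 4) ≤
      epsWC (∑ j, conj (U j)) (conj (1 : Matrix ι ι ℂ)) := by
  have htp : ∀ X, ((∑ j, conj (U j)) X).trace = X.trace := fun X => by
    rw [LinearMap.sum_apply, Matrix.trace_sum]
    conv_rhs => rw [← Matrix.one_mul X, ← hU, Finset.sum_mul, Matrix.trace_sum]
    refine Finset.sum_congr rfl fun j _ => ?_
    simp only [conj, LinearMap.coe_mk, AddHom.coe_mk]
    rw [Matrix.trace_mul_comm, Matrix.mul_assoc]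
  have hB := bellState_isState e
  refine le_trans (ENNReal.ofReal_le_ofReal ?_)
    (le_iSup_of_le 2 (le_iSup_of_le (bellState e) (le_iSup_of_le hB le_rfl)))
  have h := norm_trace_proj_mul_le hB.1.1 (bellState_mul_self e)
    (A := ampliate 2 (∑ j, conj (U j)) (bellState e) - ampliate 2 (conj 1) (bellState e))
    (by rw [Matrix.trace_sub, trace_ampliate htp, ampliate_conj_one, sub_self])
  refine le_trans ?_ h
  rw [mul_sub, Matrix.trace_sub, trace_bellState_mul_ampliate, ampliate_conj_one,
    bellState_mul_self, hB.2, ← Complex.ofReal_one, ← Complex.ofReal_sub, Complex.norm_real,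
    Real.norm_eq_abs, abs_sub_comm]
  exact le_abs_self _

end Fidelity

end CovCode
namespace CovCode

/-! ### Charge leaked by a covariant code -/

section CovariantCode

theorem conj_comp_conj {ι κ l : Type} [Fintype ι] [Fintype κ] (A : Matrix l κ ℂ)
    (B : Matrix κ ι ℂ) : conj A ∘ₗ conj B = conj (A * B) := by
  refine LinearMap.ext fun X => ?_
  simp only [conj, LinearMap.comp_apply, LinearMap.coe_mk, AddHom.coe_mk,
    Matrix.conjTranspose_mul, Matrix.mul_assoc]

theorem conj_one {ι : Type} [Fintype ι] [DecidableEq ι] :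
    conj (1 : Matrix ι ι ℂ) = LinearMap.id := by
  refine LinearMap.ext fun X => ?_
  simp [conj]

variable {n d k : ℕ}

/-- The charge of the erased qudits of `T`, rescaled so that its mean over the erased sets is the
total charge. -/
noncomputable def erasedCharge (T : Finset (Fin n)) (h : Fin d → ℝ)
    (r : WeakErasureIndex n d k) : ℝ :=
  (n / k : ℝ) * ∑ i : r.1.1, if i.1 ∈ T then h (r.2 i) else 0

/-- The total charge of the qudits of `T`. -/
def totalCharge (T : Finset (Fin n)) (h : Fin d → ℝ) (y : Fin n → Fin d) : ℝ :=
  ∑ i, if i ∈ T then h (y i) else 0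

/-- The rescaled erased charge has mean equal to the total charge and is at most `n / 2` in modulus,
so the two sides agree to first order in `θ`. -/
theorem norm_expect_exp_erasedCharge_sub_le (hk : 1 ≤ k) (hn : k ≤ n) (T : Finset (Fin n))
    {h : Fin d → ℝ} (hh : ∀ c, |h c| ≤ 1 / 2) {θ : ℝ} (hθ : 0 ≤ θ) (hθn : θ * n ≤ 1)
    (y : Fin n → Fin d) :
    ‖((n.choose k : ℂ)⁻¹ * ∑ s : Finset.powersetCard k (Finset.univ : Finset (Fin n)),
        Complex.exp ((θ * erasedCharge T h ⟨s, fun i => y i⟩ : ℝ) * Complex.I)) -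
      Complex.exp ((θ * totalCharge T h y : ℝ) * Complex.I)‖ ≤ (θ * (n / 2)) ^ 2 := by
  set P := Finset.powersetCard k (Finset.univ : Finset (Fin n)) with hP
  set O : Finset (Fin n) → ℝ := fun s => (n / k : ℝ) * ∑ i ∈ s, if i ∈ T then h (y i) else 0
  set μ := totalCharge T h y
  have hk' : (0 : ℝ) < k := by exact_mod_cast hk
  have hc : P.card = n.choose k := by simp [hP]
  have hc0 : (0 : ℝ) < n.choose k := by exact_mod_cast Nat.choose_pos hn
  have hx : ∀ i, |if i ∈ T then h (y i) else 0| ≤ 1 / 2 := fun i => by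
    split_ifs
    · exact hh _
    · norm_num
  have hOs : ∀ s : P, erasedCharge T h ⟨s, fun i => y i⟩ = O s := fun s => by
    simp only [erasedCharge, O]
    rw [Finset.sum_coe_sort s.1 fun i => if i ∈ T then h (y i) else 0]
  have hsum : ∑ s ∈ P, O s = P.card * μ := by
    rw [hc]
    exact sum_powersetCard_sum hk hn _
  have hsumle : ∀ s : Finset (Fin n), |∑ i ∈ s, if i ∈ T then h (y i) else 0| ≤ s.card * (1 / 2) :=
    fun s => (Finset.abs_sum_le_sum_abs _ _).trans (by
      rw [← nsmul_eq_mul]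
      exact Finset.sum_le_card_nsmul _ _ _ fun i _ => hx i)
  have hM : ∀ s ∈ P, |O s| ≤ n / 2 := fun s hs => by
    rw [abs_mul, abs_of_nonneg (by positivity)]
    have := mul_le_mul_of_nonneg_left (hsumle s) (by positivity : (0 : ℝ) ≤ n / k)
    rw [(Finset.mem_powersetCard.mp hs).2] at this
    refine this.trans (le_of_eq ?_)
    field_simp
  have hμ : |μ| ≤ n / 2 := by
    have := hsumle Finset.univ
    rw [Finset.card_univ, Fintype.card_fin] at this
    exact this.trans (le_of_eq (by ring))
  have hθO : ∀ s ∈ P, |θ * (O s - μ)| ≤ 1 := fun s hs => by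
    rw [abs_mul, abs_of_nonneg hθ]
    have : |O s - μ| ≤ n := (abs_sub _ _).trans (by linarith [hM s hs])
    exact (mul_le_mul_of_nonneg_left this hθ).trans hθn
  have key := norm_sum_exp_sub_card_le P hsum hM hθO
  have hfac : (n.choose k : ℂ)⁻¹ * ∑ s : P,
        Complex.exp ((θ * erasedCharge T h ⟨s, fun i => y i⟩ : ℝ) * Complex.I) -
      Complex.exp ((θ * μ : ℝ) * Complex.I) =
      (n.choose k : ℂ)⁻¹ * Complex.exp ((θ * μ : ℝ) * Complex.I) *
        (∑ s ∈ P, Complex.exp ((θ * (O s - μ) : ℝ) * Complex.I) - P.card) := by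
    have hc0' : (n.choose k : ℂ) ≠ 0 := by exact_mod_cast hc0.ne'
    simp only [hOs]
    have hexp : ∑ s ∈ P, Complex.exp ((θ * O s : ℝ) * Complex.I) =
        Complex.exp ((θ * μ : ℝ) * Complex.I) *
          ∑ s ∈ P, Complex.exp ((θ * (O s - μ) : ℝ) * Complex.I) := by
      rw [Finset.mul_sum]
      refine Finset.sum_congr rfl fun s _ => ?_
      rw [← Complex.exp_add]
      congr 1
      push_cast
      ring
    rw [Finset.sum_coe_sort P fun s => Complex.exp ((θ * O s : ℝ) * Complex.I), hexp, hc]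
    linear_combination Complex.exp ((θ * μ : ℝ) * Complex.I) * inv_mul_cancel₀ hc0'
  rw [hfac, norm_mul, norm_mul, Complex.norm_exp_ofReal_mul_I, norm_inv, Complex.norm_natCast,
    mul_one]
  rw [hc] at key
  calc _ ≤ (n.choose k : ℝ)⁻¹ * (n.choose k * (θ * (n / 2)) ^ 2) := by
        rw [hc]
        gcongr
    _ = _ := by rw [← mul_assoc, inv_mul_cancel₀ hc0.ne', one_mul]

theorem sum_norm_sq_mul_diagonal {κ ι A : Type} [Fintype κ] [DecidableEq κ] [Fintype A]
    (K : A → Matrix κ ι ℂ) (f : A → ℂ) (q : κ → ℂ) (x : ι) :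
    (∑ a, f a • ((K a)ᴴ * Matrix.diagonal q * K a)) x x =
      ∑ a, ∑ y, f a * q y * ((‖K a y x‖ ^ 2 : ℝ) : ℂ) := by
  rw [Matrix.sum_apply]
  refine Finset.sum_congr rfl fun a _ => ?_
  rw [Matrix.smul_apply, smul_eq_mul, Matrix.mul_apply, Finset.mul_sum]
  refine Finset.sum_congr rfl fun y _ => ?_
  rw [Matrix.mul_diagonal, Matrix.conjTranspose_apply, Complex.ofReal_pow, ← Complex.conj_mul', Complex.star_def]
  ring

/-- Statistics of `a` and `r` are fixed before `L` acts, so a trace-preserving decoder drops out. -/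
theorem sum_smul_conjTranspose_mul_self_comp {ι κ l m A B R : Type} [Fintype κ]
    [Fintype l] [Fintype m] [DecidableEq l] [Fintype A] [Fintype B] [Fintype R]
    (K : A → Matrix κ ι ℂ) (C : R → Matrix l κ ℂ) {L : B → Matrix m l ℂ}
    (hL : ∑ b, (L b)ᴴ * L b = 1) (f : A → ℂ) (g : R → ℂ) :
    ∑ j : B × R × A, (f j.2.2 * g j.2.1) •
        ((L j.1 * (C j.2.1 * K j.2.2))ᴴ * (L j.1 * (C j.2.1 * K j.2.2))) =
      ∑ a, f a • ((K a)ᴴ * (∑ r, g r • ((C r)ᴴ * C r)) * K a) := by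
  rw [Fintype.sum_prod_type, Finset.sum_comm, Fintype.sum_prod_type, Finset.sum_comm]
  refine Finset.sum_congr rfl fun a _ => ?_
  rw [Matrix.mul_sum, Matrix.sum_mul, Finset.smul_sum]
  refine Finset.sum_congr rfl fun r _ => ?_
  dsimp only
  rw [← Finset.smul_sum, Matrix.mul_smul, Matrix.smul_mul, smul_smul]
  congr 1
  have : ∀ b, (L b * (C r * K a))ᴴ * (L b * (C r * K a)) =
      (C r * K a)ᴴ * ((L b)ᴴ * L b) * (C r * K a) := fun b => by
    rw [Matrix.conjTranspose_mul, Matrix.mul_assoc, Matrix.mul_assoc, Matrix.mul_assoc]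
  simp only [this]
  rw [← Matrix.sum_mul, ← Matrix.mul_sum, hL, Matrix.mul_one, Matrix.conjTranspose_mul,
    Matrix.mul_assoc, Matrix.mul_assoc, Matrix.mul_assoc]

theorem comp_eq_sum_conj {ι κ l m A B R : Type} [Fintype ι] [Fintype κ]
    [Fintype l] [Fintype A] [Fintype B] [Fintype R]
    (K : A → Matrix κ ι ℂ) (C : R → Matrix l κ ℂ) (L : B → Matrix m l ℂ) :
    (∑ b, conj (L b)) ∘ₗ (∑ r, conj (C r)) ∘ₗ (∑ a, conj (K a)) =
      ∑ j : B × R × A, conj (L j.1 * (C j.2.1 * K j.2.2)) := by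
  refine LinearMap.ext fun X => ?_
  simp only [LinearMap.comp_apply, LinearMap.sum_apply, map_sum, Fintype.sum_prod_type]
  rw [Finset.sum_congr rfl fun a _ => Finset.sum_comm, Finset.sum_comm]
  refine Finset.sum_congr rfl fun b _ => ?_
  rw [Finset.sum_comm]
  refine Finset.sum_congr rfl fun r _ => Finset.sum_congr rfl fun a _ => ?_
  rw [← conj_comp_conj, ← conj_comp_conj]
  rfl

/-- The phases `exp (iθh)` of a traceless diagonal Hamiltonian form a special unitary matrix. -/
theorem diagonal_exp_mem_specialUnitaryGroup {h : Fin d → ℝ} (hh : ∑ c, h c = 0) (θ : ℝ) :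
    Matrix.diagonal (fun c => Complex.exp ((θ * h c : ℝ) * Complex.I)) ∈
      Matrix.specialUnitaryGroup (Fin d) ℂ := by
  rw [Matrix.mem_specialUnitaryGroup_iff, Matrix.mem_unitaryGroup_iff, Matrix.det_diagonal,
    ← Complex.exp_sum]
  constructor
  · rw [Matrix.star_eq_conjTranspose, Matrix.diagonal_conjTranspose, Matrix.diagonal_mul_diagonal,
      ← Matrix.diagonal_one]
    congr 1
    funext c
    rw [Pi.star_apply, Complex.star_def, Complex.mul_conj', Complex.norm_exp_ofReal_mul_I]
    simp
  · rw [← Finset.sum_mul, ← Complex.ofReal_sum, ← Finset.mul_sum, hh]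
    simp

theorem transversal_diagonal_exp (T : Finset (Fin n)) (h : Fin d → ℝ) (θ : ℝ) :
    transversal T (Matrix.diagonal fun c => Complex.exp ((θ * h c : ℝ) * Complex.I)) =
      Matrix.diagonal fun y => Complex.exp ((θ * totalCharge T h y : ℝ) * Complex.I) := by
  rw [transversal_diagonal]
  congr 1
  funext y
  simp only [totalCharge, Finset.mul_sum, Complex.ofReal_sum, Finset.sum_mul, Complex.exp_sum]
  refine Finset.prod_congr rfl fun i _ => ?_
  split_ifs <;> simp

/-- The Kraus operators of a covariant code, and a phase of the environment that reveals the
logical charge on average. -/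
theorem exists_kraus_phase (hk : 1 ≤ k) (hn : k ≤ n) {T : Finset (Fin n)}
    {E : SuperOp (Fin d) (Fin n → Fin d)} {D : SuperOp (Fin n → Option (Fin d)) (Fin d)}
    (hE : IsChannel E) (hD : IsChannel D) (hcov : IsCovariant T E)
    {h : Fin d → ℝ} (hh : ∀ c, |h c| ≤ 1 / 2) (hsum : ∑ c, h c = 0) {θ : ℝ} (hθ : 0 ≤ θ)
    (hθn : θ * n ≤ 1) :
    ∃ (J : Type) (_ : Fintype J) (U : J → Matrix (Fin d) (Fin d) ℂ) (g : J → ℂ),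
      D ∘ₗ weakErasure n d k ∘ₗ E = ∑ j, conj (U j) ∧ ∑ j, (U j)ᴴ * U j = 1 ∧
      (∀ j, ‖g j‖ = 1) ∧ ∀ x, ‖∑ j, ((∑ z, ‖U j z x‖ ^ 2 : ℝ) : ℂ) * g j -
        Complex.exp ((θ * h x : ℝ) * Complex.I)‖ ≤ (θ * (n / 2)) ^ 2 := by
  set v : Fin d → ℂ := fun c => Complex.exp ((θ * h c : ℝ) * Complex.I)
  set w : (Fin n → Fin d) → ℂ := fun y => Complex.exp ((θ * totalCharge T h y : ℝ) * Complex.I)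
  have hcov' := hcov _ (diagonal_exp_mem_specialUnitaryGroup hsum θ)
  rw [transversal_diagonal_exp] at hcov'
  have hw1 : ∀ y, ‖w y‖ = 1 := fun y => Complex.norm_exp_ofReal_mul_I _
  have hv1 : ∀ y, ‖v y‖ = 1 := fun y => Complex.norm_exp_ofReal_mul_I _
  obtain ⟨K, hK, hK1, m, hm, hKm⟩ := hE.exists_kraus v w hv1 hw1 hcov'
  -- The decoder has no symmetry; the trivial phases yield plain Kraus operators.
  obtain ⟨L, hL, hL1, -⟩ := hD.exists_kraus (fun _ => 1) (fun _ => 1) (by simp) (by simp)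
    (by rw [Matrix.diagonal_one, Matrix.diagonal_one, conj_one, conj_one]; rfl)
  have hcomp := sum_smul_conjTranspose_mul_self_comp K
    (weakErasureKraus : WeakErasureIndex n d k → _) hL1
  simp only [sum_smul_weakErasureKraus] at hcomp
  refine ⟨_, inferInstance, fun j : _ × WeakErasureIndex n d k × _ =>
      L j.1 * (weakErasureKraus j.2.1 * K j.2.2),
    fun j => star (m j.2.2) * Complex.exp ((θ * erasedCharge T h j.2.1 : ℝ) * Complex.I),
    ?_, ?_, fun j => ?_, fun x => ?_⟩
  · rw [weakErasure_eq_sum_conj, ← comp_eq_sum_conj, ← hK, ← hL]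
  · have h1 := hcomp (fun _ => 1) (fun _ => 1)
    have hc0 : (n.choose k : ℂ) ≠ 0 := by exact_mod_cast (Nat.choose_pos hn).ne'
    simpa [hK1, hc0] using h1
  · rw [norm_mul, norm_star, hm, Complex.norm_exp_ofReal_mul_I, one_mul]
  · have h1 := congr_fun₂ (hcomp (fun a => star (m a))
      (fun r => Complex.exp ((θ * erasedCharge T h r : ℝ) * Complex.I))) x x
    rw [sum_norm_sq_mul_diagonal] at h1
    set q : (Fin n → Fin d) → ℂ := fun y => (n.choose k : ℂ)⁻¹ *
      ∑ s : Finset.powersetCard k (Finset.univ : Finset (Fin n)),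
        Complex.exp ((θ * erasedCharge T h ⟨s, fun i => y i⟩ : ℝ) * Complex.I)
    have hqw : ∀ y, ‖q y - w y‖ ≤ (θ * (n / 2)) ^ 2 := fun y =>
      norm_expect_exp_erasedCharge_sub_le hk hn T hh hθ hθn y
    have hp : ∑ a, ∑ y, ‖K a y x‖ ^ 2 = 1 := by
      have h2 := sum_norm_sq_mul_diagonal K (fun _ => 1) (fun _ => 1) x
      simp only [Matrix.diagonal_one, Matrix.mul_one, one_smul, hK1, Matrix.one_apply_eq, one_mul,
        mul_one] at h2
      exact_mod_cast h2.symm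
    -- Wherever `K a y x` is nonzero, intertwining forces `w y = m a * v x`.
    have hmw : ∀ a y, star (m a) * w y * ((‖K a y x‖ ^ 2 : ℝ) : ℂ) =
        v x * ((‖K a y x‖ ^ 2 : ℝ) : ℂ) := fun a y => by
      have h3 : star (m a) * m a = 1 := by
        rw [Complex.star_def, Complex.conj_mul', hm]; simp
      rw [Complex.ofReal_pow, ← Complex.mul_conj']
      linear_combination (star (m a) * (starRingEnd ℂ) (K a y x)) * hKm a y x +
        (K a y x * (starRingEnd ℂ) (K a y x) * v x) * h3
    have h4 : ∑ j : ((Fin d) × (Fin n → Option (Fin d))) × WeakErasureIndex n d k ×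
          ((Fin n → Fin d) × Fin d),
        ((∑ z, ‖(L j.1 * (weakErasureKraus j.2.1 * K j.2.2)) z x‖ ^ 2 : ℝ) : ℂ) *
          (star (m j.2.2) * Complex.exp ((θ * erasedCharge T h j.2.1 : ℝ) * Complex.I)) - v x =
        ∑ a, ∑ y, star (m a) * (q y - w y) * ((‖K a y x‖ ^ 2 : ℝ) : ℂ) := by
      have h5 : v x = ∑ a, ∑ y, star (m a) * w y * ((‖K a y x‖ ^ 2 : ℝ) : ℂ) := by
        simp only [hmw, ← Finset.mul_sum, ← Complex.ofReal_sum, hp, Complex.ofReal_one, mul_one]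
      simp only [mul_sub, sub_mul, Finset.sum_sub_distrib, ← h5]
      refine congr_arg (· - v x) (Eq.trans ?_ h1)
      rw [Matrix.sum_apply]
      refine Finset.sum_congr rfl fun j _ => ?_
      rw [sum_norm_sq_eq_conjTranspose_mul_self, Matrix.smul_apply, smul_eq_mul, mul_comm]
    refine (congr_arg norm h4).trans_le ?_
    calc _ ≤ ∑ a, ∑ y, (θ * (n / 2)) ^ 2 * ‖K a y x‖ ^ 2 := by
          refine (norm_sum_le _ _).trans (Finset.sum_le_sum fun a _ => ?_)
          refine (norm_sum_le _ _).trans (Finset.sum_le_sum fun y _ => ?_)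
          rw [norm_mul, norm_mul, norm_star, hm, one_mul, Complex.norm_real, Real.norm_eq_abs,
            abs_of_nonneg (sq_nonneg _)]
          exact mul_le_mul_of_nonneg_right (hqw y) (sq_nonneg _)
      _ = _ := by simp only [← Finset.mul_sum, hp, mul_one]

/-- Kraus operators of high fidelity send two basis states to environment distributions of small
Hellinger distance. -/
theorem sum_sqrt_sub_sqrt_sq_le {J : Type} [Fintype J] {U : J → Matrix (Fin d) (Fin d) ℂ}
    {p q : Fin d} (hp : ∑ j, ∑ z, ‖U j z p‖ ^ 2 = 1) (hq : ∑ j, ∑ z, ‖U j z q‖ ^ 2 = 1) :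
    ∑ j, (√(∑ z, ‖U j z p‖ ^ 2) - √(∑ z, ‖U j z q‖ ^ 2)) ^ 2 ≤
      4 * (1 - ∑ j, ‖U j p p + U j q q‖ ^ 2 / 4) := by
  have hle : ∀ j x, ‖U j x x‖ ≤ √(∑ z, ‖U j z x‖ ^ 2) := fun j x =>
    Real.le_sqrt_of_sq_le (Finset.single_le_sum (f := fun z => ‖U j z x‖ ^ 2)
      (fun z _ => sq_nonneg _) (Finset.mem_univ x))
  have hj : ∀ j, (√(∑ z, ‖U j z p‖ ^ 2) - √(∑ z, ‖U j z q‖ ^ 2)) ^ 2 ≤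
      2 * ∑ z, ‖U j z p‖ ^ 2 + 2 * ∑ z, ‖U j z q‖ ^ 2 - 4 * (‖U j p p + U j q q‖ ^ 2 / 4) := by
    intro j
    have h1 := Real.sq_sqrt (Finset.sum_nonneg fun z (_ : z ∈ Finset.univ) => sq_nonneg ‖U j z p‖)
    have h2 := Real.sq_sqrt (Finset.sum_nonneg fun z (_ : z ∈ Finset.univ) => sq_nonneg ‖U j z q‖)
    -- With `a`, `b` the two square roots, this bounds `‖U j p p + U j q q‖²` by `(a + b)²`, and `(a
    -- - b)² = 2a² + 2b² - (a + b)²`.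
    have h3 := pow_le_pow_left₀ (norm_nonneg _)
      ((norm_add_le (U j p p) (U j q q)).trans (add_le_add (hle j p) (hle j q))) 2
    nlinarith
  refine (Finset.sum_le_sum fun j _ => hj j).trans (le_of_eq ?_)
  rw [Finset.sum_sub_distrib, Finset.sum_add_distrib, ← Finset.mul_sum, ← Finset.mul_sum,
    ← Finset.mul_sum, hp, hq]
  ring

/-- This `x` makes `x² N² = x/16` a small part of `sin x`. Then `0.81 ≤ 4G(1 + 2N²) ≤ 12 G N²`, and
`0.81/12 > 1/16`. -/
theorem infidelity_ge {N x G : ℝ} (hN : 1 ≤ N) (hx : x = 1 / (16 * N ^ 2))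
    (h : (Real.sin x - x ^ 2 * N ^ 2) ^ 2 ≤ 4 * G * (x ^ 2 + 2 * (x ^ 2 * N ^ 2))) :
    1 / (16 * N ^ 2) ≤ G := by
  have hN0 : 0 < N := by linarith
  have hx0 : 0 < x := by rw [hx]; positivity
  have hxN : x * N ^ 2 = 1 / 16 := by rw [hx]; field_simp
  have hN2 : 1 ≤ N ^ 2 := one_le_pow₀ hN
  have hx1 : x ≤ 1 / 16 := by nlinarith
  have hsin := Real.sin_gt_sub_cube hx0
  have h1 : 9 / 10 * x ≤ Real.sin x - x ^ 2 * N ^ 2 := by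
    have : x ^ 2 * N ^ 2 = x / 16 := by linear_combination x * hxN
    have h3 : x ^ 3 ≤ x / 256 := by nlinarith [mul_pos hx0 hx0]
    linarith
  have h2 : 81 / 100 * x ^ 2 ≤ 4 * G * (x ^ 2 + 2 * (x ^ 2 * N ^ 2)) := by
    refine le_trans ?_ h
    have := pow_le_pow_left₀ (by positivity) h1 2
    linarith
  have h3 : 81 / 100 ≤ 4 * G * (1 + 2 * N ^ 2) := by
    have : x ^ 2 * (81 / 100) ≤ x ^ 2 * (4 * G * (1 + 2 * N ^ 2)) := by linarith
    exact le_of_mul_le_mul_left this (by positivity)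
  have hG : 0 ≤ G := by
    by_contra hG
    have : 4 * G * (1 + 2 * N ^ 2) < 0 := mul_neg_of_neg_of_pos (by linarith) (by positivity)
    linarith
  rw [div_le_iff₀ (by positivity)]
  nlinarith

end CovariantCode

end CovCode

/-! ### The bound -/

theorem proposition1 (d n nₑ : ℕ) (hd : 2 ≤ d) (hₑ : 1 ≤ nₑ) (hn : nₑ ≤ n)
    (T : Finset (Fin n))
    (E : CovCode.SuperOp (Fin d) (Fin n → Fin d))
    (D : CovCode.SuperOp (Fin n → Option (Fin d)) (Fin d))
    (hE : CovCode.IsChannel E) (hD : CovCode.IsChannel D)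
    (hcov : CovCode.IsCovariant T E) :
    ENNReal.ofReal (1 / (16 * (n : ℝ) ^ 2 * (1 + 1 / (nₑ : ℝ)))) ≤
      CovCode.epsCov T (CovCode.weakErasure n d nₑ) E D := by
  have hN : (1 : ℝ) ≤ n := by exact_mod_cast hₑ.trans hn
  set x : ℝ := 1 / (16 * (n : ℝ) ^ 2) with hx
  have hxpos : 0 < x := by positivity
  set p : Fin d := ⟨0, by omega⟩ with hp
  set q : Fin d := ⟨1, by omega⟩ with hq
  have hpq : p ≠ q := by simp [hp, hq]
  set h : Fin d → ℝ := fun c => (if c = p then 1 / 2 else 0) - if c = q then 1 / 2 else 0 with hh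
  have hhp : h p = 1 / 2 := by simp [hh, hpq]
  have hhq : h q = -(1 / 2) := by simp [hh, hpq.symm]
  have hhle : ∀ c, |h c| ≤ 1 / 2 := fun c => by
    simp only [hh]
    split_ifs <;> norm_num
  have hhsum : ∑ c, h c = 0 := by simp [hh]
  have hθn : 2 * x * n ≤ 1 := by
    rw [hx, mul_one_div, div_mul_eq_mul_div, div_le_one (by positivity)]
    nlinarith
  obtain ⟨J, _, U, g, hU, hU1, hg, hUg⟩ :=
    CovCode.exists_kraus_phase hₑ hn hE hD hcov hhle hhsum (by positivity) hθn
  have hnorm : ∀ c, ∑ j, ∑ z, ‖U j z c‖ ^ 2 = 1 := fun c => by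
    have h1 := congr_fun₂ hU1 c c
    rw [Matrix.sum_apply, Matrix.one_apply_eq] at h1
    simp only [← CovCode.sum_norm_sq_eq_conjTranspose_mul_self, ← Complex.ofReal_sum] at h1
    exact_mod_cast h1
  have hsq : ∀ j c, √(∑ z, ‖U j z c‖ ^ 2) ^ 2 = ∑ z, ‖U j z c‖ ^ 2 := fun j c =>
    Real.sq_sqrt (Finset.sum_nonneg fun z _ => sq_nonneg _)
  have hell := CovCode.sum_sqrt_sub_sqrt_sq_le (hnorm p) (hnorm q)
  set G := 1 - ∑ j, ‖U j p p + U j q q‖ ^ 2 / 4 with hG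
  have hδ : (2 * x * (n / 2)) ^ 2 = x ^ 2 * (n : ℝ) ^ 2 := by ring
  have hle : x ^ 2 * (n : ℝ) ^ 2 ≤ Real.sin x := by
    have hxn : x * (n : ℝ) ^ 2 = 1 / 16 := by rw [hx]; field_simp
    have hN2 : 1 ≤ (n : ℝ) ^ 2 := one_le_pow₀ hN
    have hx1 : x ≤ 1 / 16 := by nlinarith
    have h1 : x ^ 2 * (n : ℝ) ^ 2 = x / 16 := by linear_combination x * hxn
    have h2 : x ^ 3 ≤ x / 256 := by nlinarith [mul_pos hxpos hxpos]
    linarith [Real.sin_gt_sub_cube hxpos]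
  have hUp := hUg p
  have hUq := hUg q
  rw [hδ, hhp, show 2 * x * (1 / 2) = x by ring] at hUp
  rw [hδ, hhq, show 2 * x * -(1 / 2) = -x by ring, Complex.ofReal_neg] at hUq
  have hphase := CovCode.le_sum_sub_sq_of_phase (a := fun j => √(∑ z, ‖U j z p‖ ^ 2))
    (b := fun j => √(∑ z, ‖U j z q‖ ^ 2)) (by simp only [hsq, hnorm]) (by simp only [hsq, hnorm])
    hg (by simpa only [hsq] using hUp) (by simpa only [hsq] using hUq) hle
  have hfid : 1 / (16 * (n : ℝ) ^ 2) ≤ G :=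
    CovCode.infidelity_ge hN hx (hphase.trans (mul_le_mul_of_nonneg_right hell (by positivity)))
  have heps := CovCode.one_sub_fidelity_le_epsWC ![p, q] hU1
  have htr : CovCode.transversal T (1 : Matrix (Fin d) (Fin d) ℂ) = 1 := by
    have := CovCode.transversal_diagonal T (1 : Fin d → ℂ)
    simpa using this
  refine le_trans (ENNReal.ofReal_le_ofReal ?_) (heps.trans ?_)
  -- The factor `1 + 1/nₑ ≥ 1` only weakens the bound.
  · refine le_trans ?_ hfid
    refine one_div_le_one_div_of_le (by positivity) (le_mul_of_one_le_right (by positivity) ?_)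
    have : (0 : ℝ) ≤ 1 / nₑ := by positivity
    linarith
  · refine le_iSup_of_le (1 : Matrix.specialUnitaryGroup (Fin d) ℂ) (le_of_eq ?_)
    rw [OneMemClass.coe_one, htr, CovCode.conj_one, CovCode.conj_one, LinearMap.id_comp, hU]
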